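/- Let $(\Omega,\mathcal F,Q)$ be a probability space carrying a standard real Brownian motion $(B_t)_{t\ge 0}$ (with $B_0=0$ and continuous paths, almost surely), and let $a>0$. For $x>0$ and real $\nu$ put $$A^{(\nu)}_x=\int_0^x e^{2(B_w+\nu w)}\,dw,\qquad L(x,\nu)=E^Q\big[(A^{(\nu)}_x-a)^+\big].$$ For every $x>0$ and every real $\nu$ this expectation is finite, and for every $x>0$ the function $\nu\mapsto L(x,\nu)$ extends from the real line to a (necessarily unique) entire function on $\mathbb C$, again denoted $\nu\mapsto L(x,\nu)$. With this extension, for complex $\nu$ and $z$ let $$F(\nu)(z)=\int_0^\infty e^{-zx}L(x,\nu)\,dx .$$ (i) For any complex number $\nu$, the Laplace transform $F(\nu)(z)$ is finite (i.e. $x\mapsto e^{-zx}L(x,\nu)$ is Lebesgue integrable on $(0,\infty)$) for any complex number $z$ with $\operatorname{Re}(z)>\max\{0,\tfrac12(\operatorname{Im}\nu)^2+2(\operatorname{Re}\nu+1)\}$. (ii) For any complex number $z$ with positive real part, the map $\nu\mapsto F(\nu)(z)$ is analytic at every complex number $\nu$ with $\operatorname{Re}(z)>\tfrac12(\operatorname{Im}\nu)^2+2(\operatorname{Re}\nu+1)$.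 -/

import Mathlib

open MeasureTheory ProbabilityTheory Set
open scoped NNReal

noncomputable section

/-- Yor's process with drift `ν` at time `x`: `A_x^{(ν)} = ∫_0^x e^{2 (B_w + ν w)} dw`. -/
def yorProcess {Ω : Type*} (B : ℝ≥0 → Ω → ℝ) (ν x : ℝ) (ω : Ω) : ℝ :=
  ∫ w in (0 : ℝ)..x, Real.exp (2 * (B w.toNNReal ω + ν * w))

/-- The payoff `(A_x^{(ν)} - a)^+`. -/
def yorPayoff {Ω : Type*} (B : ℝ≥0 → Ω → ℝ) (a x ν : ℝ) (ω : Ω) : ℝ :=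
  max (yorProcess B ν x ω - a) 0

/-- The expectation `E^Q[(A_x^{(ν)} - a)^+]`, for a real drift `ν`. -/
def realOptionValue {Ω : Type*} [MeasurableSpace Ω] (Q : Measure Ω) (B : ℝ≥0 → Ω → ℝ)
    (a x ν : ℝ) : ℝ :=
  ∫ ω, yorPayoff B a x ν ω ∂Q

/-- `g` is an entire function whose restriction to the real line is `f`. -/
def IsEntireExtension (f : ℝ → ℝ) (g : ℂ → ℂ) : Prop :=
  Differentiable ℂ g ∧ ∀ r : ℝ, g (r : ℂ) = ((f r : ℝ) : ℂ)

/-- The entire function that extends `f` to the complex plane. If there is one, it is unique by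
the identity theorem; if there is none, the value is meaningless. -/
def entireExtension (f : ℝ → ℝ) : ℂ → ℂ :=
  Classical.epsilon (IsEntireExtension f)

/-- `L(x, ν)` for complex `ν`: the entire extension of `ν ↦ E^Q[(A_x^{(ν)} - a)^+]`. -/
def optionValue {Ω : Type*} [MeasurableSpace Ω] (Q : Measure Ω) (B : ℝ≥0 → Ω → ℝ)
    (a x : ℝ) (ν : ℂ) : ℂ :=
  entireExtension (fun r : ℝ => realOptionValue Q B a x r) ν

/-- The integrand `e^{-z x} L(x, ν)` of the Laplace transform. -/
def laplaceIntegrand {Ω : Type*} [MeasurableSpace Ω] (Q : Measure Ω) (B : ℝ≥0 → Ω → ℝ)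
    (a : ℝ) (ν z : ℂ) (x : ℝ) : ℂ :=
  Complex.exp (-z * (x : ℂ)) * optionValue Q B a x ν

/-- The Laplace transform `F(ν)(z) = ∫_0^∞ e^{-z x} L(x, ν) dx`. -/
def optionLaplace {Ω : Type*} [MeasurableSpace Ω] (Q : Measure Ω) (B : ℝ≥0 → Ω → ℝ)
    (a : ℝ) (ν z : ℂ) : ℂ :=
  ∫ x in Ioi (0 : ℝ), laplaceIntegrand Q B a ν z x

end

/-!
The payoff grows only while Yor's process is above the level `a`: since `A^{(ν)}` is increasing
and starts below `a`, `(A_x^{(ν)} - a)^+ = ∫_0^x e^{2 (B_w + ν w)} 1_{A_w^{(ν)} > a} dw`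
(`max_integral_sub_eq_integral_indicator`). Taking expectations at each time `w` and removing the
drift there by the Cameron–Martin formula (`integral_yor_cameronMartin`) gives, for real `ν`,
`L(x, ν) = ∫_0^x h(w, ν) dw` with
`h(w, ν) = E[e^{ν B_w - ν² w / 2} e^{2 B_w} 1_{A_w > a}]` and `A = A^{(0)}`; this is
`realOptionValue_eq_integral_payoffRate`, and `h` is `payoffRate`.

The right-hand side makes sense for complex `ν` and is entire in `ν`, so it is the entire extension.
Bounding the indicator by `1` and using the Gaussian moment generating function,
`|h(w, ν)| ≤ e^{w c(ν)}` with `c(ν) = (Im ν)² / 2 + 2 (Re ν + 1)` (`norm_payoffRate_le`). Hence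
`|L(x, ν)| ≤ e^{c x} / c` for every `c > 0` with `c ≥ c(ν)`, which gives the integrability of the
Laplace integrand for `Re z > max 0 c(ν)`; since `c` is continuous the bound is locally uniform in
`ν`, and holomorphy passes through the integral (`differentiableOn_integral_of_locally_dominated`).

The Cameron–Martin formula is needed for one fixed time `w` only. There the path on `[0, w]` is a
function of its bridge and its endpoint `B_w`, which are independent; the drift moves the endpoint
and leaves the bridge alone, so the formula reduces to the fact that an exponential tilt shifts the
mean of a Gaussian variable. To have joint measurability, `B` is first replaced by an
indistinguishable process with continuous paths and measurable coordinates.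
-/

/-! ### Holomorphic dependence of an integral on a parameter -/

/-- A parametric integral is holomorphic as soon as its integrand is holomorphic in the parameter
and locally dominated: by Cauchy's estimate a local bound for the integrand also controls its
derivative. -/
theorem differentiableOn_integral_of_locally_dominated {α : Type*} [MeasurableSpace α]
    {μ : Measure α} {U : Set ℂ} {F : ℂ → α → ℂ}
    (hmeas : ∀ ν ∈ U, AEStronglyMeasurable (F ν) μ)
    (hhol : ∀ x, DifferentiableOn ℂ (fun ν => F ν x) U)
    (hbound : ∀ ν ∈ U, ∃ r > 0, Metric.ball ν r ⊆ U ∧ ∃ g : α → ℝ, Integrable g μ ∧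
      ∀ᵐ x ∂μ, ∀ ξ ∈ Metric.ball ν r, ‖F ξ x‖ ≤ g x) :
    DifferentiableOn ℂ (fun ν => ∫ x, F ν x ∂μ) U := by
  intro ν hν
  obtain ⟨r, hr, hrU, g, hg, hFg⟩ := hbound ν hν
  have hd : ∀ x, ∀ ξ ∈ Metric.ball ν r, HasDerivAt (fun ξ => F ξ x) (deriv (fun ξ => F ξ x) ξ) ξ :=
    fun x ξ hξ => (((hhol x).mono hrU).differentiableAt
      (Metric.isOpen_ball.mem_nhds hξ)).hasDerivAt
  have hν' : ν ∈ Metric.ball ν r := Metric.mem_ball_self hr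
  have hmeas' : AEStronglyMeasurable (fun x => deriv (fun ξ => F ξ x) ν) μ := by
    -- The derivative is a pointwise limit of difference quotients along a sequence.
    obtain ⟨u, hu⟩ := Filter.exists_seq_tendsto (nhdsWithin ν {ν}ᶜ)
    have hev : ∀ᶠ n in Filter.atTop, u n ∈ U :=
      hu.eventually (nhdsWithin_le_nhds (Filter.mem_of_superset (Metric.ball_mem_nhds ν hr) hrU))
    obtain ⟨N, hN⟩ := Filter.eventually_atTop.1 hev
    refine aestronglyMeasurable_of_tendsto_ae Filter.atTop
      (f := fun n x => slope (fun ξ => F ξ x) ν (u (n + N))) (fun n => ?_)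
      (Filter.Eventually.of_forall fun x => ?_)
    · simp only [slope_def_module]
      exact ((hmeas _ (hN (n + N) (by omega))).sub (hmeas _ hν)).const_smul ((u (n + N) - ν)⁻¹)
    · exact ((hasDerivAt_iff_tendsto_slope.1 (hd x ν hν')).comp hu).comp
        (Filter.tendsto_add_atTop_nat N)
  refine (hasDerivAt_integral_of_dominated_loc_of_deriv_le (s := Metric.ball ν (r / 2))
    (bound := fun x => g x / (r / 4)) (F' := fun ξ x => deriv (fun ξ => F ξ x) ξ)
    (Metric.ball_mem_nhds ν (by positivity)) ?_ ?_ hmeas' ?_ (hg.div_const _)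
    ?_).2.differentiableAt.differentiableWithinAt
  · filter_upwards [Metric.ball_mem_nhds ν hr] with ξ hξ using hmeas ξ (hrU hξ)
  · exact hg.mono' (hmeas ν hν) (hFg.mono fun x hx => hx ν hν')
  · filter_upwards [hFg] with x hx ξ hξ
    have hsub : Metric.closedBall ξ (r / 4) ⊆ Metric.ball ν r := by
      refine Metric.closedBall_subset_ball' ?_
      have := Metric.mem_ball.1 hξ
      linarith
    refine Complex.norm_deriv_le_of_forall_mem_sphere_norm_le (by positivity) ?_
      fun z hz => hx z (hsub (Metric.sphere_subset_closedBall hz))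
    refine DifferentiableOn.diffContOnCl ?_
    exact (hhol x).mono (Metric.closure_ball_subset_closedBall.trans (hsub.trans hrU))
  · exact Filter.Eventually.of_forall fun x ξ hξ =>
      hd x ξ (Metric.ball_subset_ball (by linarith) hξ)

/-! ### The positive part of a primitive above a level -/

/-- If the primitive `A` of a positive function starts at `0 < a`, then `(A x - a)^+` is
accumulated exactly while `A` exceeds `a`. -/
theorem max_integral_sub_eq_integral_indicator {f : ℝ → ℝ} (hf : Continuous f)
    (hpos : ∀ w, 0 < f w) {a x : ℝ} (ha : 0 < a) (hx : 0 ≤ x) :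
    max ((∫ w in (0 : ℝ)..x, f w) - a) 0 =
      ∫ w in (0 : ℝ)..x, {w | a < ∫ s in (0 : ℝ)..w, f s}.indicator f w := by
  set A : ℝ → ℝ := fun w => ∫ s in (0 : ℝ)..w, f s with hA
  have hint : ∀ u v : ℝ, IntervalIntegrable f volume u v := fun u v => hf.intervalIntegrable u v
  have hmono : Monotone A := by
    intro u v huv
    have : A v - A u = ∫ s in u..v, f s := intervalIntegral.integral_interval_sub_left
      (hint _ _) (hint _ _)
    have h2 : 0 ≤ ∫ s in u..v, f s :=
      intervalIntegral.integral_nonneg huv fun s _ => (hpos s).le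
    linarith
  have hcont : Continuous A := intervalIntegral.continuous_primitive hint 0
  have hA0 : A 0 = 0 := intervalIntegral.integral_same
  rcases le_or_gt (A x) a with hxa | hxa
  · rw [max_eq_right (by simpa [hA] using hxa)]
    symm
    rw [intervalIntegral.integral_of_le hx]
    refine setIntegral_eq_zero_of_forall_eq_zero fun w hw => indicator_of_notMem ?_ _
    exact not_lt.2 ((hmono hw.2).trans hxa)
  · obtain ⟨y, hy, hya⟩ := intermediate_value_Icc hx hcont.continuousOn
      (show a ∈ Icc (A 0) (A x) from ⟨by rw [hA0]; exact ha.le, hxa.le⟩)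
    have hstrict : ∀ w, y < w → a < A w := by
      intro w hw
      have : A w - A y = ∫ s in y..w, f s := intervalIntegral.integral_interval_sub_left
        (hint _ _) (hint _ _)
      have h2 : 0 < ∫ s in y..w, f s :=
        intervalIntegral.intervalIntegral_pos_of_pos (hint _ _) hpos hw
      linarith
    have hset : {w | a < A w} = Ioi y := by
      ext w
      refine ⟨fun h => ?_, fun h => hstrict w h⟩
      by_contra hle
      exact absurd (hmono (not_lt.1 hle)) (not_le.2 (by rw [hya]; exact h))
    have : A x - A y = ∫ s in y..x, f s := intervalIntegral.integral_interval_sub_left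
        (hint _ _) (hint _ _)
    rw [max_eq_left (by simpa [hA] using hxa.le)]
    change A x - a = ∫ w in (0 : ℝ)..x, {w | a < A w}.indicator f w
    rw [hset, intervalIntegral.integral_of_le hx, setIntegral_indicator measurableSet_Ioi,
      ← hya, this, intervalIntegral.integral_of_le hy.2]
    congr 2
    ext w
    simp only [mem_Ioc, mem_inter_iff, mem_Ioi]
    exact ⟨fun h => ⟨⟨hy.1.trans_lt h.1, h.2⟩, h.1⟩, fun h => ⟨h.2, h.1.2⟩⟩

/-! ### Exponential change of measure for Gaussian variables -/

/-- Tilting a centred Gaussian by `exp (r y - r² v / 2)` shifts its mean by `v r`. -/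
theorem gaussianReal_withDensity_exp {v : ℝ≥0} (hv : v ≠ 0) (r : ℝ) :
    (gaussianReal 0 v).withDensity (fun y => ENNReal.ofReal (Real.exp (r * y - r ^ 2 * v / 2))) =
      (gaussianReal 0 v).map (fun y => y + v * r) := by
  rw [gaussianReal_map_add_const, gaussianReal_of_var_ne_zero _ hv,
    gaussianReal_of_var_ne_zero _ hv,
    ← withDensity_mul _ (measurable_gaussianPDF 0 v) (by fun_prop)]
  congr 1
  ext y
  have hv' : (v : ℝ) ≠ 0 := by exact_mod_cast hv
  rw [Pi.mul_apply, gaussianPDF, gaussianPDF, ← ENNReal.ofReal_mul (gaussianPDFReal_nonneg _ _ _),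
    gaussianPDFReal, gaussianPDFReal, mul_assoc, ← Real.exp_add]
  congr 3
  field_simp
  ring

/-- Cameron–Martin in one direction: if `W` is a centred Gaussian independent of `X`, then for
functionals of `X` and `W` shifting `W` amounts to reweighting by the exponential martingale. -/
theorem integral_shift_gaussian_of_indepFun {Ω S : Type*} [MeasurableSpace Ω] [MeasurableSpace S]
    {Q : Measure Ω} [IsProbabilityMeasure Q] {X : Ω → S} {W : Ω → ℝ} (hX : Measurable X)
    (hW : Measurable W) (hind : IndepFun X W Q) {v : ℝ≥0} (hv : v ≠ 0)
    (hlaw : Q.map W = gaussianReal 0 v) {f : S → ℝ → ℝ}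
    (hf : Measurable (Function.uncurry f)) (r : ℝ) :
    ∫ ω, f (X ω) (W ω + v * r) ∂Q =
      ∫ ω, Real.exp (r * W ω - r ^ 2 * v / 2) * f (X ω) (W ω) ∂Q := by
  have hprod : Q.map (fun ω => (X ω, W ω)) = (Q.map X).prod (gaussianReal 0 v) := by
    rw [← hlaw]
    exact (indepFun_iff_map_prod_eq_prod_map_map hX.aemeasurable hW.aemeasurable).1 hind
  set P : Measure S := Q.map X with hP
  have hPp : IsProbabilityMeasure P := Measure.isProbabilityMeasure_map hX.aemeasurable
  have key : ∀ g : S × ℝ → ℝ, Measurable g →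
      ∫ ω, g (X ω, W ω) ∂Q = ∫ p, g p ∂(P.prod (gaussianReal 0 v)) := by
    intro g hg
    rw [← hprod, integral_map (hX.prodMk hW).aemeasurable hg.aestronglyMeasurable]
  have hshift : Measurable (Prod.map (id : S → S) (fun y : ℝ => y + v * r)) := by fun_prop
  have h1 := key (fun p => f p.1 (p.2 + v * r)) (hf.comp hshift)
  have h2 := key (fun p => Real.exp (r * p.2 - r ^ 2 * v / 2) * f p.1 p.2)
    (Measurable.mul (by fun_prop) hf)
  have h3 : (P.prod (gaussianReal 0 v)).map (Prod.map (id : S → S) (fun y : ℝ => y + v * r)) =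
      (P.prod (gaussianReal 0 v)).withDensity
        (fun p => ENNReal.ofReal (Real.exp (r * p.2 - r ^ 2 * v / 2))) := by
    rw [← prod_withDensity_right
      (g := fun y => ENNReal.ofReal (Real.exp (r * y - r ^ 2 * v / 2))) (by fun_prop),
      gaussianReal_withDensity_exp hv r,
      ← Measure.map_prod_map P (gaussianReal 0 v) measurable_id (by fun_prop), Measure.map_id]
  have h4 := integral_withDensity_eq_integral_toReal_smul (μ := P.prod (gaussianReal 0 v))
    (f := fun p => ENNReal.ofReal (Real.exp (r * p.2 - r ^ 2 * v / 2))) (by fun_prop)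
    (Filter.Eventually.of_forall fun _ => ENNReal.ofReal_lt_top) (Function.uncurry f)
  rw [← h3, integral_map hshift.aemeasurable hf.aestronglyMeasurable] at h4
  rw [h1, h2]
  refine Eq.trans h4 (integral_congr_ae (Filter.Eventually.of_forall fun p => ?_))
  change (ENNReal.ofReal _).toReal • f p.1 p.2 = _
  rw [ENNReal.toReal_ofReal (Real.exp_pos _).le, smul_eq_mul]

/-! ### Regular versions of Brownian motion -/

/-- Brownian motion is indistinguishable from a process all of whose paths are continuous and all
of whose coordinates are measurable. -/
theorem exists_continuous_measurable_version {Ω : Type*} [MeasurableSpace Ω] {Q : Measure Ω}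
    {B : ℝ≥0 → Ω → ℝ} (hB : IsBrownianReal B Q) :
    ∃ C : ℝ≥0 → Ω → ℝ, (∀ t, Measurable (C t)) ∧ (∀ ω, Continuous fun t => C t ω) ∧
      ∀ᵐ ω ∂Q, ∀ t, B t ω = C t ω := by
  classical
  obtain ⟨D, hDc, hDd⟩ := TopologicalSpace.exists_countable_dense ℝ≥0
  have hae : ∀ᵐ ω ∂Q, Continuous (fun t => B t ω) ∧
      ∀ t ∈ D, B t ω = (hB.aemeasurable t).mk (B t) ω := by
    refine hB.cont.and ((ae_ball_iff hDc).2 fun t _ => (hB.aemeasurable t).ae_eq_mk)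
  obtain ⟨N, hNsub, hNmeas, hN0⟩ := exists_measurable_superset_of_null (ae_iff.1 hae)
  have hgood : ∀ ω ∉ N, Continuous (fun t => B t ω) ∧
      ∀ t ∈ D, B t ω = (hB.aemeasurable t).mk (B t) ω := by
    intro ω hω
    by_contra h
    exact hω (hNsub h)
  refine ⟨fun t => Nᶜ.indicator (B t), fun t => ?_, fun ω => ?_, ?_⟩
  · obtain ⟨u, huD, hu⟩ := mem_closure_iff_seq_limit.1 (hDd t)
    refine measurable_of_tendsto_metrizable
      (f := fun n => Nᶜ.indicator ((hB.aemeasurable (u n)).mk (B (u n)))) (fun n =>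
        (hB.aemeasurable (u n)).measurable_mk.indicator hNmeas.compl) (tendsto_pi_nhds.2 fun ω => ?_)
    by_cases hω : ω ∈ N
    · simp [hω]
    · have hω' : ω ∈ Nᶜ := hω
      simp only [indicator_of_mem hω']
      refine (((hgood ω hω).1.tendsto t).comp hu).congr fun n => ?_
      exact (hgood ω hω).2 _ (huD n)
  · by_cases hω : ω ∈ N
    · simpa [hω] using continuous_const
    · have hω' : ω ∈ Nᶜ := hω
      simpa only [indicator_of_mem hω'] using (hgood ω hω).1
  · have : ∀ᵐ ω ∂Q, ω ∉ N := measure_eq_zero_iff_ae_notMem.1 hN0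
    filter_upwards [this] with ω hω t
    rw [indicator_of_mem (show ω ∈ Nᶜ from hω)]

theorem measurable_uncurry_toNNReal {Ω : Type*} [MeasurableSpace Ω] {C : ℝ≥0 → Ω → ℝ}
    (hm : ∀ t, Measurable (C t))
    (hc : ∀ ω, Continuous fun t => C t ω) :
    Measurable fun p : ℝ × Ω => C p.1.toNNReal p.2 :=
  (measurable_uncurry_of_continuous_of_measurable hc hm).comp
    (measurable_real_toNNReal.prodMap measurable_id)

theorem continuous_yorIntegrand {Ω : Type*} {C : ℝ≥0 → Ω → ℝ}
    (hc : ∀ ω, Continuous fun t => C t ω) (r : ℝ) (ω : Ω) :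
    Continuous fun w : ℝ => Real.exp (2 * (C w.toNNReal ω + r * w)) := by
  have := (hc ω).comp continuous_real_toNNReal
  simp only [Function.comp_def] at this
  fun_prop

theorem measurable_intervalIntegral_of_measurable_uncurry {Ω : Type*} [MeasurableSpace Ω]
    {f : Ω → ℝ → ℝ}
    (hf : Measurable (Function.uncurry f)) (u v : ℝ) :
    Measurable fun ω => ∫ s in u..v, f ω s := by
  simp only [intervalIntegral]
  exact (hf.stronglyMeasurable.integral_prod_right).measurable.sub
    (hf.stronglyMeasurable.integral_prod_right).measurable

theorem measurable_yorProcess {Ω : Type*} [MeasurableSpace Ω] {C : ℝ≥0 → Ω → ℝ}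
    (hm : ∀ t, Measurable (C t))
    (hc : ∀ ω, Continuous fun t => C t ω) (r : ℝ) :
    Measurable fun p : ℝ × Ω => yorProcess C r p.1 p.2 := by
  have hj := measurable_uncurry_toNNReal hm hc
  refine measurable_uncurry_of_continuous_of_measurable (u := fun w ω => yorProcess C r w ω)
    (fun ω => ?_) (fun w => ?_)
  · exact intervalIntegral.continuous_primitive
      (fun u v => (continuous_yorIntegrand hc r ω).intervalIntegrable u v) 0
  · refine measurable_intervalIntegral_of_measurable_uncurry
      (f := fun ω s => Real.exp (2 * (C s.toNNReal ω + r * s))) ?_ 0 w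
    have : Measurable fun p : Ω × ℝ => C p.2.toNNReal p.1 := hj.comp measurable_swap
    exact ((this.add (measurable_snd.const_mul r)).const_mul 2).exp

/-! ### The Cameron–Martin formula for Yor's process -/

/-- The process `B_s - (min s w / w) B_w`, a Brownian bridge on `[0, w]`, is independent of the
endpoint `B_w`: the two are jointly Gaussian and uncorrelated. -/
theorem indepFun_bridge_endpoint {Ω : Type*} [MeasurableSpace Ω] {Q : Measure Ω}
    [IsProbabilityMeasure Q] {C : ℝ≥0 → Ω → ℝ} (hC : IsPreBrownianReal C Q) {w : ℝ≥0}
    (hw : w ≠ 0) :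
    IndepFun (fun ω s => C s ω - (min s w : ℝ≥0) / w * C w ω) (C w) Q := by
  have hind : IndepFun (fun ω s => C s ω - (min s w : ℝ≥0) / w * C w ω)
      (fun ω (_ : Unit) => C w ω) Q := by
    have hL : ∀ t, MemLp (C t) 2 Q := fun t =>
      (hC.isGaussianProcess.hasGaussianLaw_eval t).memLp_two
    have hae := fun t => hC.aemeasurable t
    refine IsGaussianProcess.indepFun_of_covariance_eq_zero
      (X := fun s ω => C s ω - (min s w : ℝ≥0) / w * C w ω) (Y := fun _ => C w) ?_
      (fun s => by fun_prop) (fun _ => hae w) fun s _ => ?_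
    · refine hC.isGaussianProcess.of_isGaussianProcess ?_
      rintro (s | s)
      · exact ⟨{s, w},
          { toFun x := x ⟨s, by simp⟩ - (min s w : ℝ≥0) / w * x ⟨w, by simp⟩
            map_add' x y := by simp; ring
            map_smul' c x := by simp; ring }, by simp⟩
      · exact ⟨{w},
          { toFun x := x ⟨w, by simp⟩
            map_add' x y := by simp
            map_smul' c x := by simp }, by simp⟩
    · have hw' : (w : ℝ) ≠ 0 := by exact_mod_cast hw
      rw [covariance_fun_sub_left (hL s) ((hL w).const_mul _) (hL w),
        covariance_const_mul_left, hC.covariance_eval, hC.covariance_fun_eval, min_self]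
      field_simp
      simp
  exact hind.comp (φ := id) (ψ := fun y : Unit → ℝ => y ()) measurable_id (by fun_prop)

/-- The Cameron–Martin formula for the part of `E[dA_w^{(r)} 1_{A_w^{(r)} > a}]` at time `w`: the
drift `r` is removed at the price of the exponential martingale. The path on `[0, w]` is a
function of its bridge and its endpoint, and the drift acts on the endpoint only. -/
theorem integral_yor_cameronMartin {Ω : Type*} [MeasurableSpace Ω] {Q : Measure Ω}
    [IsProbabilityMeasure Q] {C : ℝ≥0 → Ω → ℝ} (hC : IsPreBrownianReal C Q)
    (hm : ∀ t, Measurable (C t)) (hc : ∀ ω, Continuous fun t => C t ω) (a r : ℝ) {w : ℝ≥0}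
    (hw : w ≠ 0) :
    ∫ ω, {ω | a < yorProcess C r w ω}.indicator
        (fun ω => Real.exp (2 * (C w ω + r * w))) ω ∂Q =
      ∫ ω, {ω | a < yorProcess C 0 w ω}.indicator
        (fun ω => Real.exp (r * C w ω - r ^ 2 * w / 2 + 2 * C w ω)) ω ∂Q := by
  have hw' : (w : ℝ) ≠ 0 := by exact_mod_cast hw
  have hbc : ∀ ω, Continuous fun s : ℝ≥0 => C s ω - (min s w : ℝ≥0) / w * C w ω := by
    intro ω
    have := hc ω
    fun_prop
  -- The bridge as a random element of the space of continuous paths.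
  set X : Ω → {p : ℝ≥0 → ℝ // Continuous p} :=
    fun ω => ⟨fun s => C s ω - (min s w : ℝ≥0) / w * C w ω, hbc ω⟩ with hXdef
  have hX : Measurable X := by
    refine Measurable.subtype_mk (measurable_pi_lambda _ fun s => ?_)
    have := hm s
    have := hm w
    fun_prop
  have hind : IndepFun X (C w) Q := by
    have h := indepFun_bridge_endpoint hC hw
    rw [IndepFun_iff_Indep] at h ⊢
    have : MeasurableSpace.comap X inferInstance =
        MeasurableSpace.comap (fun ω s => C s ω - (min s w : ℝ≥0) / w * C w ω) inferInstance :=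
      MeasurableSpace.comap_comp (f := Subtype.val) (g := X)
    rwa [this]
  let I : {p : ℝ≥0 → ℝ // Continuous p} → ℝ → ℝ := fun p y =>
    ∫ s in (0 : ℝ)..w, Real.exp (2 * (p.1 s.toNNReal + s / w * y))
  have hI : Measurable (Function.uncurry I) := by
    have hev : Measurable fun q : ℝ × {p : ℝ≥0 → ℝ // Continuous p} => q.2.1 q.1.toNNReal :=
      measurable_uncurry_toNNReal (C := fun t (p : {p : ℝ≥0 → ℝ // Continuous p}) => p.1 t)
        (fun t => (measurable_pi_apply t).comp measurable_subtype_coe) fun p => p.2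
    refine measurable_intervalIntegral_of_measurable_uncurry
      (f := fun (q : {p : ℝ≥0 → ℝ // Continuous p} × ℝ) s =>
        Real.exp (2 * (q.1.1 s.toNNReal + s / w * q.2))) ?_ 0 w
    have : Measurable fun q : ({p : ℝ≥0 → ℝ // Continuous p} × ℝ) × ℝ =>
        q.1.1.1 q.2.toNNReal := hev.comp (measurable_snd.prodMk (measurable_fst.comp measurable_fst))
    simp only [Function.uncurry_def]
    fun_prop
  let f : {p : ℝ≥0 → ℝ // Continuous p} → ℝ → ℝ := fun p y =>
    {q : {p : ℝ≥0 → ℝ // Continuous p} × ℝ | a < I q.1 q.2}.indicator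
      (fun q => Real.exp (2 * q.2)) (p, y)
  have hf : Measurable (Function.uncurry f) :=
    Measurable.indicator (by fun_prop) (measurableSet_lt measurable_const hI)
  have hIyor : ∀ (ρ : ℝ) (ω : Ω), I (X ω) (C w ω + w * ρ) = yorProcess C ρ w ω := by
    intro ρ ω
    refine intervalIntegral.integral_congr fun s hs => ?_
    rw [uIcc_of_le w.coe_nonneg] at hs
    have hsw : (min s.toNNReal w : ℝ≥0) = s.toNNReal :=
      min_eq_left (Real.toNNReal_le_iff_le_coe.2 hs.2)
    simp only [hXdef, hsw, Real.coe_toNNReal s hs.1]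
    congr 2
    field_simp
    ring
  have hfyor : ∀ (ρ : ℝ) (ω : Ω), f (X ω) (C w ω + w * ρ) =
      {ω | a < yorProcess C ρ w ω}.indicator (fun ω => Real.exp (2 * (C w ω + ρ * w))) ω := by
    intro ρ ω
    simp only [f, indicator, mem_ofPred_eq, hIyor, mul_comm ρ]
  have key := integral_shift_gaussian_of_indepFun hX (hm w) hind hw (hC.hasLaw_eval w).map_eq hf r
  simp only [hfyor] at key
  rw [key]
  refine integral_congr_ae (Filter.Eventually.of_forall fun ω => ?_)
  have h0 := hfyor 0 ω
  simp only [mul_zero, add_zero, zero_mul] at h0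
  simp only [h0, indicator]
  split_ifs
  · rw [← Real.exp_add]
  · simp

/-! ### The expected rate of growth of the payoff at complex drift -/

/-- The exponential rate `(Im ν)² / 2 + 2 (Re ν + 1)`. -/
noncomputable def growthRate (ν : ℂ) : ℝ := ν.im ^ 2 / 2 + 2 * (ν.re + 1)

/-- The integrand of `payoffRate`: on the event `A_w > a`, the rate `e^{2 B_w}` of growth of `A`
weighted by the complex exponential martingale `e^{ν B_w - ν² w / 2}`. -/
noncomputable def weightedRate {Ω : Type*} (C : ℝ≥0 → Ω → ℝ) (a : ℝ) (ν : ℂ) (w : ℝ) (ω : Ω) : ℂ :=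
  {ω | a < yorProcess C 0 w ω}.indicator
    (fun ω => Complex.exp (ν * C w.toNNReal ω - ν ^ 2 * w / 2 + 2 * C w.toNNReal ω)) ω

/-- The derivative in the maturity `w` of the option value, `E[e^{ν B_w - ν² w / 2} e^{2 B_w}
1_{A_w > a}]`, where `A` has no drift and `ν` may be complex. -/
noncomputable def payoffRate {Ω : Type*} [MeasurableSpace Ω] (Q : Measure Ω) (C : ℝ≥0 → Ω → ℝ)
    (a : ℝ) (ν : ℂ) (w : ℝ) : ℂ :=
  ∫ ω, weightedRate C a ν w ω ∂Q

theorem continuous_growthRate : Continuous growthRate := by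
  unfold growthRate
  fun_prop

theorem exists_ball_growthRate_lt {ν : ℂ} {c : ℝ} (h : growthRate ν < c) :
    ∃ r > 0, ∀ ξ ∈ Metric.ball ν r, growthRate ξ < c :=
  Metric.eventually_nhds_iff_ball.1 (continuous_growthRate.continuousAt.eventually_lt_const h)

theorem norm_weightedRate_le {Ω : Type*} (C : ℝ≥0 → Ω → ℝ) (a : ℝ) (ν : ℂ) (w : ℝ) (ω : Ω) :
    ‖weightedRate C a ν w ω‖ ≤
      Real.exp ((ν.re + 2) * C w.toNNReal ω) * Real.exp (-(ν.re ^ 2 - ν.im ^ 2) * w / 2) := by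
  refine (norm_indicator_le_norm_self _ _).trans (le_of_eq ?_)
  rw [Complex.norm_exp, ← Real.exp_add]
  congr 1
  simp [pow_two]
  ring

theorem integrable_exp_mul_brownian {Ω : Type*} [MeasurableSpace Ω] {Q : Measure Ω}
    {C : ℝ≥0 → Ω → ℝ} (hC : IsPreBrownianReal C Q) (t : ℝ) (w : ℝ≥0) :
    Integrable (fun ω => Real.exp (t * C w ω)) Q := by
  have h := integrable_exp_mul_gaussianReal (μ := 0) (v := w) t
  rw [← (hC.hasLaw_eval w).map_eq] at h
  exact h.comp_aemeasurable (hC.aemeasurable w)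

theorem integral_exp_mul_brownian {Ω : Type*} [MeasurableSpace Ω] {Q : Measure Ω}
    {C : ℝ≥0 → Ω → ℝ} (hC : IsPreBrownianReal C Q) (t : ℝ) (w : ℝ≥0) :
    ∫ ω, Real.exp (t * C w ω) ∂Q = Real.exp (w * t ^ 2 / 2) := by
  have h := mgf_gaussianReal (hC.hasLaw_eval w).map_eq t
  simpa [mgf] using h

theorem measurable_weightedRate {Ω : Type*} [MeasurableSpace Ω] {C : ℝ≥0 → Ω → ℝ}
    (hm : ∀ t, Measurable (C t)) (hc : ∀ ω, Continuous fun t => C t ω) (a : ℝ) (ν : ℂ) :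
    Measurable fun p : ℝ × Ω => weightedRate C a ν p.1 p.2 := by
  have h1 := measurable_uncurry_toNNReal hm hc
  have h2 : Measurable fun p : ℝ × Ω => (C p.1.toNNReal p.2 : ℂ) :=
    Complex.measurable_ofReal.comp h1
  have h3 : Measurable fun p : ℝ × Ω => (p.1 : ℂ) := Complex.measurable_ofReal.comp measurable_fst
  exact Measurable.indicator (s := {p : ℝ × Ω | a < yorProcess C 0 p.1 p.2})
    ((((h2.const_mul ν).sub ((h3.const_mul (ν ^ 2)).div_const 2)).add (h2.const_mul 2)).cexp)
    (measurableSet_lt measurable_const (measurable_yorProcess hm hc 0))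

theorem measurable_payoffRate {Ω : Type*} [MeasurableSpace Ω] {Q : Measure Ω} [SFinite Q]
    {C : ℝ≥0 → Ω → ℝ} (hm : ∀ t, Measurable (C t)) (hc : ∀ ω, Continuous fun t => C t ω)
    (a : ℝ) (ν : ℂ) : Measurable (payoffRate Q C a ν) :=
  ((measurable_weightedRate hm hc a ν).stronglyMeasurable.integral_prod_right
    (f := fun w ω => weightedRate C a ν w ω)).measurable

/-- The bound that carries the growth estimate: discarding the event `A_w > a` costs nothing in
modulus, and `E|e^{ν B_w - ν² w / 2} e^{2 B_w}|` is computed exactly. -/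
theorem norm_payoffRate_le {Ω : Type*} [MeasurableSpace Ω] {Q : Measure Ω}
    {C : ℝ≥0 → Ω → ℝ} (hC : IsPreBrownianReal C Q) (a : ℝ) (ν : ℂ) {w : ℝ} (hw : 0 ≤ w) :
    ‖payoffRate Q C a ν w‖ ≤ Real.exp (growthRate ν * w) := by
  refine (norm_integral_le_of_norm_le ((integrable_exp_mul_brownian hC (ν.re + 2)
    w.toNNReal).mul_const _) (Filter.Eventually.of_forall fun ω =>
      norm_weightedRate_le C a ν w ω)).trans (le_of_eq ?_)
  rw [integral_mul_const, integral_exp_mul_brownian hC, ← Real.exp_add, Real.coe_toNNReal w hw]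
  congr 1
  unfold growthRate
  ring

theorem norm_payoffRate_le_of_growthRate_le {Ω : Type*} [MeasurableSpace Ω] {Q : Measure Ω}
    {C : ℝ≥0 → Ω → ℝ} (hC : IsPreBrownianReal C Q) (a : ℝ) {ν : ℂ} {c w : ℝ} (hw : 0 ≤ w)
    (h : growthRate ν ≤ c) : ‖payoffRate Q C a ν w‖ ≤ Real.exp (c * w) :=
  (norm_payoffRate_le hC a ν hw).trans (Real.exp_le_exp.2 (mul_le_mul_of_nonneg_right h hw))

/-- `payoffRate` is entire in the drift. For `|ξ - ν| ≤ 1` the integrand is dominated through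
`e^{t B} ≤ e^{(s + 1) B} + e^{(s - 1) B}` for `|t - s| ≤ 1`, one term for each sign of `B`. -/
theorem differentiable_payoffRate {Ω : Type*} [MeasurableSpace Ω] {Q : Measure Ω}
    {C : ℝ≥0 → Ω → ℝ} (hC : IsPreBrownianReal C Q) (hm : ∀ t, Measurable (C t))
    (hc : ∀ ω, Continuous fun t => C t ω) (a w : ℝ) :
    Differentiable ℂ fun ν => payoffRate Q C a ν w := by
  rw [← differentiableOn_univ]
  refine differentiableOn_integral_of_locally_dominated (fun ν _ =>
    ((measurable_weightedRate hm hc a ν).comp measurable_prodMk_left).aestronglyMeasurable)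
    (fun ω => ?_) fun ν _ => ⟨1, one_pos, subset_univ _,
      fun ω => (Real.exp ((ν.re + 1 + 2) * C w.toNNReal ω) +
        Real.exp ((ν.re - 1 + 2) * C w.toNNReal ω)) *
          Real.exp (((ν.re ^ 2 + 2 * |ν.re| + 1) + (ν.im ^ 2 + 2 * |ν.im| + 1)) * |w| / 2), ?_,
      Filter.Eventually.of_forall fun ω ξ hξ => ?_⟩
  · unfold weightedRate
    simp only [indicator]
    split_ifs <;> fun_prop
  · exact ((integrable_exp_mul_brownian hC _ _).add
      (integrable_exp_mul_brownian hC _ _)).mul_const _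
  · refine (norm_weightedRate_le C a ξ w ω).trans ?_
    rw [Metric.mem_ball, dist_eq_norm] at hξ
    have hre := abs_le.1 ((Complex.abs_re_le_norm (ξ - ν)).trans hξ.le)
    have him := abs_le.1 ((Complex.abs_im_le_norm (ξ - ν)).trans hξ.le)
    rw [Complex.sub_re] at hre
    rw [Complex.sub_im] at him
    refine mul_le_mul ?_ (Real.exp_le_exp.2 ?_) (Real.exp_pos _).le (by positivity)
    · rcases le_total 0 (C w.toNNReal ω) with h | h
      · exact (Real.exp_le_exp.2 (mul_le_mul_of_nonneg_right (by linarith [hre.2]) h)).trans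
          (le_add_of_nonneg_right (Real.exp_pos _).le)
      · exact (Real.exp_le_exp.2 (mul_le_mul_of_nonpos_right (by linarith [hre.1]) h)).trans
          (le_add_of_nonneg_left (Real.exp_pos _).le)
    -- The remaining factor depends on `w` alone, so a crude bound suffices.
    · have hsq : ∀ {s t : ℝ}, -1 ≤ s - t → s - t ≤ 1 → s ^ 2 ≤ t ^ 2 + 2 * |t| + 1 := by
        intro s t h1 h2
        have : |s| ≤ |t| + 1 := by
          have := abs_sub_abs_le_abs_sub s t
          have := abs_le.2 ⟨h1, h2⟩
          linarith
        rw [← sq_abs s, ← sq_abs t]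
        nlinarith [abs_nonneg s, abs_nonneg t]
      have h1 : |-(ξ.re ^ 2 - ξ.im ^ 2)| ≤
          (ν.re ^ 2 + 2 * |ν.re| + 1) + (ν.im ^ 2 + 2 * |ν.im| + 1) :=
        abs_le.2 ⟨by nlinarith [hsq hre.1 hre.2, sq_nonneg ξ.im, hsq him.1 him.2, sq_nonneg ξ.re],
          by nlinarith [hsq hre.1 hre.2, sq_nonneg ξ.im, hsq him.1 him.2, sq_nonneg ξ.re]⟩
      have h2 : -(ξ.re ^ 2 - ξ.im ^ 2) * w ≤ |-(ξ.re ^ 2 - ξ.im ^ 2)| * |w| := by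
        rw [← abs_mul]
        exact le_abs_self _
      have h3 := mul_le_mul_of_nonneg_right h1 (abs_nonneg w)
      linarith

theorem integrableOn_exp_mul_Ioc (c x : ℝ) :
    IntegrableOn (fun w : ℝ => Real.exp (c * w)) (Ioc 0 x) :=
  (Continuous.integrableOn_Icc (by fun_prop)).mono_set Ioc_subset_Icc_self

/-! ### The entire extension of the option value -/

theorem differentiable_integral_payoffRate {Ω : Type*} [MeasurableSpace Ω] {Q : Measure Ω}
    [SFinite Q] {C : ℝ≥0 → Ω → ℝ} (hC : IsPreBrownianReal C Q) (hm : ∀ t, Measurable (C t))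
    (hc : ∀ ω, Continuous fun t => C t ω) (a x : ℝ) :
    Differentiable ℂ fun ν => ∫ w in Ioc 0 x, payoffRate Q C a ν w := by
  rw [← differentiableOn_univ]
  refine differentiableOn_integral_of_locally_dominated
    (fun ν _ => (measurable_payoffRate hm hc a ν).aestronglyMeasurable)
    (fun w => (differentiable_payoffRate hC hm hc a w).differentiableOn) fun ν _ => ?_
  obtain ⟨r, hr, hball⟩ := exists_ball_growthRate_lt (lt_add_one (growthRate ν))
  exact ⟨r, hr, subset_univ _, _, integrableOn_exp_mul_Ioc (growthRate ν + 1) x,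
    (ae_restrict_mem measurableSet_Ioc).mono fun w hw ξ hξ =>
      norm_payoffRate_le_of_growthRate_le hC a hw.1.le (hball ξ hξ).le⟩

/-- For a real drift, the payoff is integrable and its expectation is the integral of
`payoffRate`: the payoff grows at rate `e^{2 (B_w + r w)}` while `A^{(r)} > a`, by Fubini the
expectation is taken at each time, and there the Cameron–Martin formula removes the drift. -/
theorem realOptionValue_eq_integral_payoffRate {Ω : Type*} [MeasurableSpace Ω] {Q : Measure Ω}
    [IsProbabilityMeasure Q] {C : ℝ≥0 → Ω → ℝ} (hC : IsPreBrownianReal C Q)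
    (hm : ∀ t, Measurable (C t)) (hc : ∀ ω, Continuous fun t => C t ω) {a x : ℝ} (ha : 0 < a)
    (hx : 0 ≤ x) (r : ℝ) :
    Integrable (yorPayoff C a x r) Q ∧
      (realOptionValue Q C a x r : ℂ) = ∫ w in Ioc 0 x, payoffRate Q C a r w := by
  let G : ℝ → Ω → ℝ := fun w ω => {ω | a < yorProcess C r w ω}.indicator
    (fun ω => Real.exp (2 * (C w.toNNReal ω + r * w))) ω
  have hpay : ∀ ω, yorPayoff C a x r ω = ∫ w in Ioc 0 x, G w ω := by
    intro ω
    rw [← intervalIntegral.integral_of_le hx]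
    exact max_integral_sub_eq_integral_indicator (continuous_yorIntegrand hc r ω)
      (fun _ => Real.exp_pos _) ha hx
  have hGm : Measurable (Function.uncurry G) :=
    Measurable.indicator (s := {p : ℝ × Ω | a < yorProcess C r p.1 p.2})
      (((measurable_uncurry_toNNReal hm hc).add (measurable_fst.const_mul r)).const_mul 2).exp
      (measurableSet_lt measurable_const (measurable_yorProcess hm hc r))
  have hG0 : ∀ w ω, 0 ≤ G w ω := fun w ω => indicator_nonneg (fun _ _ => (Real.exp_pos _).le) _
  have hGle : ∀ w ω, G w ω ≤ Real.exp (2 * C w.toNNReal ω) * Real.exp (2 * r * w) := by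
    intro w ω
    refine (indicator_le_self' (fun _ _ => (Real.exp_pos _).le) _).trans (le_of_eq ?_)
    rw [← Real.exp_add]
    ring_nf
  have hGi : ∀ w, Integrable (G w) Q := fun w =>
    ((integrable_exp_mul_brownian hC 2 w.toNNReal).mul_const (Real.exp (2 * r * w))).mono'
      (hGm.comp measurable_prodMk_left).aestronglyMeasurable
      (Filter.Eventually.of_forall fun ω => by
        rw [Real.norm_of_nonneg (hG0 w ω)]
        exact hGle w ω)
  have hprod : Integrable (Function.uncurry G) ((volume.restrict (Ioc 0 x)).prod Q) := by
    refine (integrable_prod_iff hGm.aestronglyMeasurable).2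
      ⟨Filter.Eventually.of_forall hGi, ?_⟩
    refine (integrableOn_exp_mul_Ioc (2 + 2 * r) x).mono'
      (hGm.norm.stronglyMeasurable.integral_prod_right
        (f := fun w ω => ‖G w ω‖)).aestronglyMeasurable
      ((ae_restrict_mem measurableSet_Ioc).mono fun w hw => ?_)
    rw [Real.norm_of_nonneg (integral_nonneg fun _ => norm_nonneg _)]
    calc ∫ ω, ‖G w ω‖ ∂Q
        ≤ ∫ ω, Real.exp (2 * C w.toNNReal ω) * Real.exp (2 * r * w) ∂Q :=
          integral_mono (hGi w).norm ((integrable_exp_mul_brownian hC 2 _).mul_const _)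
            fun ω => (Real.norm_of_nonneg (hG0 w ω)).le.trans (hGle w ω)
      _ = Real.exp ((2 + 2 * r) * w) := by
          rw [integral_mul_const, integral_exp_mul_brownian hC, ← Real.exp_add,
            Real.coe_toNNReal w hw.1.le]
          ring_nf
  refine ⟨hprod.integral_prod_right.congr (Filter.Eventually.of_forall fun ω => (hpay ω).symm), ?_⟩
  have hval : realOptionValue Q C a x r = ∫ w in Ioc 0 x, ∫ ω, G w ω ∂Q := by
    rw [realOptionValue, integral_integral_swap hprod]
    exact integral_congr_ae (Filter.Eventually.of_forall hpay)
  rw [hval, ← integral_complex_ofReal]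
  refine setIntegral_congr_fun measurableSet_Ioc fun w hw => ?_
  have hcm := integral_yor_cameronMartin hC hm hc a r (w := w.toNNReal)
    (Real.toNNReal_pos.2 hw.1).ne'
  rw [Real.coe_toNNReal w hw.1.le] at hcm
  change ((∫ ω, G w ω ∂Q : ℝ) : ℂ) = _
  rw [show ∫ ω, G w ω ∂Q = _ from hcm, ← integral_complex_ofReal]
  refine integral_congr_ae (Filter.Eventually.of_forall fun ω => ?_)
  simp only [weightedRate, indicator]
  split_ifs
  · push_cast
    rfl
  · simp

/-- Entire extensions are unique, by the identity theorem along the real sequence `1 / (n + 1)`. -/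
theorem IsEntireExtension.eq {f : ℝ → ℝ} {g₁ g₂ : ℂ → ℂ} (h₁ : IsEntireExtension f g₁)
    (h₂ : IsEntireExtension f g₂) : g₁ = g₂ := by
  refine AnalyticOnNhd.eq_of_frequently_eq (z₀ := 0)
    (fun z _ => h₁.1.analyticAt z) (fun z _ => h₂.1.analyticAt z) ?_
  have ht : Filter.Tendsto (fun n : ℕ => (((1 / ((n : ℝ) + 1) : ℝ)) : ℂ)) Filter.atTop
      (nhdsWithin 0 {0}ᶜ) := by
    refine tendsto_nhdsWithin_iff.2 ⟨?_, Filter.Eventually.of_forall fun n => ?_⟩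
    · exact (Complex.continuous_ofReal.tendsto' 0 0 Complex.ofReal_zero).comp
        tendsto_one_div_add_atTop_nhds_zero_nat
    · have : (1 / ((n : ℝ) + 1) : ℝ) ≠ 0 := by positivity
      simpa using Complex.ofReal_ne_zero.2 this
  exact ht.frequently (Filter.Eventually.of_forall fun n => by rw [h₁.2, h₂.2]).frequently

/-! ### The Laplace transform -/

/-- The growth estimate for the option value at complex drift. Bounding `(A_x - a)^+` by `A_x`
under the complex weight would only give the rate `(Im ν)² / 2` when `Re ν < -1`, hence the
integration of the pointwise bound for `payoffRate`. -/
theorem norm_integral_payoffRate_le {Ω : Type*} [MeasurableSpace Ω] {Q : Measure Ω}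
    {C : ℝ≥0 → Ω → ℝ} (hC : IsPreBrownianReal C Q) (a : ℝ) {ν : ℂ} {c x : ℝ} (hc0 : 0 < c)
    (h : growthRate ν ≤ c) (hx : 0 ≤ x) :
    ‖∫ w in Ioc 0 x, payoffRate Q C a ν w‖ ≤ Real.exp (c * x) / c := by
  refine (norm_integral_le_of_norm_le (integrableOn_exp_mul_Ioc c x)
    ((ae_restrict_mem measurableSet_Ioc).mono fun w hw =>
      norm_payoffRate_le_of_growthRate_le hC a hw.1.le h)).trans ?_
  rw [← intervalIntegral.integral_of_le hx, intervalIntegral.integral_comp_mul_left _ hc0.ne',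
    integral_exp, smul_eq_mul, mul_zero, Real.exp_zero, div_eq_inv_mul]
  exact mul_le_mul_of_nonneg_left (by linarith) (by positivity)

theorem measurable_integral_payoffRate {Ω : Type*} [MeasurableSpace Ω] {Q : Measure Ω} [SFinite Q]
    {C : ℝ≥0 → Ω → ℝ} (hm : ∀ t, Measurable (C t)) (hc : ∀ ω, Continuous fun t => C t ω)
    (a : ℝ) (ν : ℂ) : Measurable fun x : ℝ => ∫ w in Ioc 0 x, payoffRate Q C a ν w := by
  have : Measurable fun p : ℝ × ℝ => (Ioc 0 p.1).indicator (payoffRate Q C a ν) p.2 :=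
    Measurable.indicator (s := {p : ℝ × ℝ | 0 < p.2 ∧ p.2 ≤ p.1})
      ((measurable_payoffRate hm hc a ν).comp measurable_snd)
      ((measurableSet_lt measurable_const measurable_snd).inter
        (measurableSet_le measurable_snd measurable_fst))
  simp_rw [← integral_indicator measurableSet_Ioc]
  exact (this.stronglyMeasurable.integral_prod_right
    (f := fun x w => (Ioc 0 x).indicator (payoffRate Q C a ν) w)).measurable

theorem norm_laplace_payoffRate_le {Ω : Type*} [MeasurableSpace Ω] {Q : Measure Ω}
    {C : ℝ≥0 → Ω → ℝ} (hC : IsPreBrownianReal C Q) (a : ℝ) {ν : ℂ} (z : ℂ) {c x : ℝ} (hc0 : 0 < c)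
    (h : growthRate ν ≤ c) (hx : 0 ≤ x) :
    ‖Complex.exp (-z * x) * ∫ w in Ioc 0 x, payoffRate Q C a ν w‖ ≤
      Real.exp ((c - z.re) * x) / c := by
  rw [norm_mul, Complex.norm_exp]
  calc Real.exp (-z * x).re * ‖∫ w in Ioc 0 x, payoffRate Q C a ν w‖
      ≤ Real.exp (-z * x).re * (Real.exp (c * x) / c) :=
        mul_le_mul_of_nonneg_left (norm_integral_payoffRate_le hC a hc0 h hx) (Real.exp_pos _).le
    _ = Real.exp ((c - z.re) * x) / c := by
        rw [← mul_div_assoc, ← Real.exp_add]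
        congr 2
        simp
        ring

theorem integrableOn_laplace_bound {c d : ℝ} (h : c < d) :
    IntegrableOn (fun x : ℝ => Real.exp ((c - d) * x) / c) (Ioi 0) :=
  (integrableOn_exp_mul_Ioi (sub_neg.2 h) 0).div_const c

theorem integrableOn_laplace_payoffRate {Ω : Type*} [MeasurableSpace Ω] {Q : Measure Ω} [SFinite Q]
    {C : ℝ≥0 → Ω → ℝ} (hC : IsPreBrownianReal C Q) (hm : ∀ t, Measurable (C t))
    (hc : ∀ ω, Continuous fun t => C t ω) (a : ℝ) {ν z : ℂ} (hz : max 0 (growthRate ν) < z.re) :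
    IntegrableOn (fun x : ℝ => Complex.exp (-z * x) * ∫ w in Ioc 0 x, payoffRate Q C a ν w)
      (Ioi 0) := by
  obtain ⟨c, hc1, hc2⟩ := exists_between hz
  refine (integrableOn_laplace_bound hc2).mono'
    (Measurable.mul (by fun_prop) (measurable_integral_payoffRate hm hc a ν)).aestronglyMeasurable
    ((ae_restrict_mem measurableSet_Ioi).mono fun x hx => ?_)
  exact norm_laplace_payoffRate_le hC a z ((le_max_left _ _).trans_lt hc1)
    ((le_max_right _ _).trans hc1.le) (le_of_lt hx)

theorem differentiableOn_laplace_payoffRate {Ω : Type*} [MeasurableSpace Ω] {Q : Measure Ω}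
    [SFinite Q] {C : ℝ≥0 → Ω → ℝ} (hC : IsPreBrownianReal C Q) (hm : ∀ t, Measurable (C t))
    (hc : ∀ ω, Continuous fun t => C t ω) (a : ℝ) {z : ℂ} (hz : 0 < z.re) :
    DifferentiableOn ℂ (fun ν => ∫ x in Ioi (0 : ℝ),
      Complex.exp (-z * x) * ∫ w in Ioc 0 x, payoffRate Q C a ν w) {ν | growthRate ν < z.re} := by
  refine differentiableOn_integral_of_locally_dominated
    (fun ν hν => (integrableOn_laplace_payoffRate hC hm hc a (max_lt hz hν)).aestronglyMeasurable)
    (fun x => ((differentiable_integral_payoffRate hC hm hc a x).const_mul _).differentiableOn)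
    fun ν hν => ?_
  obtain ⟨c, hc1, hc2⟩ := exists_between (max_lt hz hν)
  obtain ⟨r, hr, hball⟩ := exists_ball_growthRate_lt ((le_max_right _ _).trans_lt hc1)
  exact ⟨r, hr, fun ξ hξ => (hball ξ hξ).trans hc2, _, integrableOn_laplace_bound hc2,
    (ae_restrict_mem measurableSet_Ioi).mono fun x hx ξ hξ =>
      norm_laplace_payoffRate_le hC a z ((le_max_left _ _).trans_lt hc1) (hball ξ hξ).le
        (le_of_lt hx)⟩

theorem mainTheorem5 {Ω : Type*} [MeasurableSpace Ω] (Q : Measure Ω) [IsProbabilityMeasure Q]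
    (B : ℝ≥0 → Ω → ℝ) (hB : IsBrownianReal B Q) (a : ℝ) (ha : 0 < a) :
    (∀ x : ℝ, 0 < x →
      (∀ ν : ℝ, Integrable (yorPayoff B a x ν) Q) ∧
      IsEntireExtension (fun ν : ℝ => realOptionValue Q B a x ν) (optionValue Q B a x)) ∧
    (∀ ν z : ℂ, max 0 (ν.im ^ 2 / 2 + 2 * (ν.re + 1)) < z.re →
      IntegrableOn (laplaceIntegrand Q B a ν z) (Ioi (0 : ℝ))) ∧
    (∀ z : ℂ, 0 < z.re →
      AnalyticOnNhd ℂ (fun ν : ℂ => optionLaplace Q B a ν z)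
        {ν : ℂ | ν.im ^ 2 / 2 + 2 * (ν.re + 1) < z.re}) := by
  obtain ⟨C, hm, hc, hBC⟩ := exists_continuous_measurable_version hB
  have hC : IsPreBrownianReal C Q :=
    hB.toIsPreBrownianReal.congr fun t => hBC.mono fun ω hω => hω t
  have hpay : ∀ x r : ℝ, yorPayoff C a x r =ᵐ[Q] yorPayoff B a x r := by
    intro x r
    filter_upwards [hBC] with ω hω
    simp only [yorPayoff, yorProcess, hω]
  have hreal : ∀ x r : ℝ, realOptionValue Q B a x r = realOptionValue Q C a x r :=
    fun x r => integral_congr_ae (hpay x r).symm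
  have hext : ∀ x : ℝ, 0 < x → IsEntireExtension (fun r : ℝ => realOptionValue Q B a x r)
      (fun ν => ∫ w in Ioc 0 x, payoffRate Q C a ν w) := fun x hx =>
    ⟨differentiable_integral_payoffRate hC hm hc a x, fun r => by
      simp only [hreal, (realOptionValue_eq_integral_payoffRate hC hm hc ha hx.le r).2]⟩
  -- An entire extension exists, so the value selected in `entireExtension` is that extension.
  have hopt : ∀ x : ℝ, 0 < x → IsEntireExtension (fun r : ℝ => realOptionValue Q B a x r)
      (optionValue Q B a x) := fun x hx => Classical.epsilon_spec ⟨_, hext x hx⟩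
  have hlap : ∀ ν z : ℂ, EqOn
      (fun x : ℝ => Complex.exp (-z * x) * ∫ w in Ioc 0 x, payoffRate Q C a ν w)
      (laplaceIntegrand Q B a ν z) (Ioi 0) := by
    intro ν z x hx
    simp only [laplaceIntegrand, (hopt x hx).eq (hext x hx)]
  refine ⟨fun x hx => ⟨fun r => ?_, hopt x hx⟩, fun ν z hz => ?_, fun z hz => ?_⟩
  · exact (realOptionValue_eq_integral_payoffRate hC hm hc ha hx.le r).1.congr (hpay x r)
  · exact (integrableOn_laplace_payoffRate hC hm hc a hz).congr_fun (hlap ν z) measurableSet_Ioi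
  · refine DifferentiableOn.analyticOnNhd ?_ (isOpen_lt continuous_growthRate continuous_const)
    refine (differentiableOn_laplace_payoffRate hC hm hc a hz).congr fun ν _ => ?_
    exact (setIntegral_congr_fun measurableSet_Ioi (hlap ν z)).symm
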